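/- **Setting.** Let $Q$ be a finite-dimensional smooth manifold, $\pi_Q:T^*Q\to Q$ its cotangent bundle with the canonical symplectic form $\omega=\sum_i dq^i\wedge dp_i$, and for a smooth $f:T^*Q\to\mathbb R$ let $X_f$ be the vector field on $T^*Q$ with $\mathbf i_{X_f}\omega=\mathbf df$. Let $G$ be a Lie group acting smoothly on $Q$ such that the cotangent lifted action on $T^*Q$ is free and proper, and let $T^*Q/G$ be the orbit manifold, with the surjective submersion $\pi_{/G}:T^*Q\to T^*Q/G$. Let $(T^*Q,G,\omega,\mathcal D,H,F,W)$ be a nonholonomic RCH system with symmetry and $u$ a control law. That is: $\mathcal D\subset TQ$ is a $G$-invariant, completely nonholonomic smooth distribution of constant rank; $L:TQ\to\mathbb R$ is a smooth hyperregular Lagrangian (its Legendre transformation $\mathcal FL:TQ\to T^*Q$ is a diffeomorphism) whose fibre Hessian is nondegenerate on $\mathcal D$; the Hamiltonian $H(\mathcal FL(v))=\langle \mathcal FL(v),v\rangle-L(v)$ is $G$-invariant; the smooth fibre-preserving force map $F:T^*Q\to T^*Q$ and the control subset $W\subset T^*Q$ are $G$-invariant; and $u:T^*Q\to W$ is smooth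 and fibre-preserving. For a fibre-preserving map $F$ put $\mathrm{vlift}(F)X_H(\alpha)=$ the vertical part (with respect to a fixed connection on $T^*Q\to Q$) of $TF(X_H(\alpha))$, displaced parallelly from $F(\alpha)$ to $\alpha$ in the fibre. *Distributional system.* Let $\mathcal M=\mathcal FL(\mathcal D)$, $\mathcal F=(T\pi_Q)^{-1}(\mathcal D)$, $\mathcal F^\perp$ its $\omega$-orthogonal, $\mathcal K=\mathcal F\cap T\mathcal M$ along $\mathcal M$, and assume $\dim\mathcal M=\operatorname{rank}\mathcal F$ and $T\mathcal M\cap\mathcal F^\perp=\{0\}$ along $\mathcal M$, so that the restriction $\omega_{\mathcal K}$ of $\omega$ to $\mathcal K$ is nondegenerate. Let $\tau_{\mathcal K}$ be the $\omega$-orthogonal projection onto $\mathcal K$; let $X_{\mathcal K}$ be the vector field on $\mathcal M$ with values in $\mathcal K$ such that $\omega_{\mathcal K}(X_{\mathcal K},v)=\mathbf dH(v)$ for all $v\in\mathcal K$; and let $\tilde X=X_{\mathcal K}+\tau_{\mathcal K}\,\mathrm{vlift}(F)X_H+\tau_{\mathcal K}\,\mathrm{vlift}(u)X_H$ on $\mathcal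 M$. *Reduced system.* Let $\mathcal V$ be the distribution tangent to the $G$-orbits, $\mathcal U=\{w\in\mathcal K:\ \omega_{\mathcal K}(w,v)=0\ \ \forall v\in\mathcal V\cap\mathcal K\}$, $\bar{\mathcal M}=\pi_{/G}(\mathcal M)$, $\bar{\mathcal K}=T\pi_{/G}(\mathcal U)$, $\bar{\mathcal F}^\perp=T\pi_{/G}(\mathcal F^\perp)$, $T\bar{\mathcal M}=T\pi_{/G}(T\mathcal M)$, and assume $T\bar{\mathcal M}\cap\bar{\mathcal F}^\perp=\{0\}$. Let $\tau_{\bar{\mathcal K}}$ be the projection of $\bar{\mathcal K}\oplus\bar{\mathcal F}^\perp$ onto $\bar{\mathcal K}$ along $\bar{\mathcal F}^\perp$. Let $\omega_{\bar{\mathcal K}}$ be the two-form on $\bar{\mathcal K}$ with $\pi_{/G}^*\omega_{\bar{\mathcal K}}=\omega|_{\mathcal U}$, let $h_{\bar{\mathcal K}}:T^*Q/G\to\mathbb R$ be the reduced Hamiltonian, $h_{\bar{\mathcal K}}\circ\pi_{/G}=H$, and let $X_{\bar{\mathcal K}}$ be the vector field on $\bar{\mathcal M}$ with values in $\bar{\mathcal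 K}$ such that $\omega_{\bar{\mathcal K}}(X_{\bar{\mathcal K}},w)=\mathbf dh_{\bar{\mathcal K}}(w)$ for all $w\in\bar{\mathcal K}$. **Theorem 4.3 (Type II Hamilton-Jacobi theorem for a nonholonomic reduced distributional RCH system).** Let $\gamma:Q\to T^*Q$ be a smooth $G$-invariant one-form with $\mathrm{Im}(\gamma)\subset\mathcal M$, let $\lambda=\gamma\circ\pi_Q$, and let $\varepsilon:T^*Q\to T^*Q$ be a $G$-invariant (that is, commuting with the action) smooth symplectic map with $\varepsilon(\mathcal M)\subset\mathcal M$. Put $\bar\gamma=\pi_{/G}\circ\gamma$, $\bar\lambda=\pi_{/G}\circ\lambda$, $\bar\varepsilon=\pi_{/G}\circ\varepsilon$ and $\tilde X^\varepsilon=T\pi_Q\cdot\tilde X\cdot\varepsilon$. Then $\varepsilon$ and $\bar\varepsilon$ satisfy $$\tau_{\bar{\mathcal K}}\cdot T\bar\varepsilon\cdot X_{h_{\bar{\mathcal K}}\circ\bar\varepsilon}=T\bar\lambda\cdot\tilde X\cdot\varepsilon$$ on $\mathcal M$ if and only if they satisfy the Type II Hamilton-Jacobi equation $$T\bar\gamma\cdot\tilde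 X^\varepsilon=X_{\bar{\mathcal K}}\cdot\bar\varepsilon$$ on $\mathcal M$, both being equations in the tangent bundle $T(T^*Q/G)$. More generally, for every subset $A\subset\mathcal M$ the first equation holds at all points of $A$ if and only if the second one does. -/

import Mathlib

open scoped Manifold ContDiff Topology
open Bundle

namespace NonholonomicRCH

noncomputable section

/-! ## The cotangent bundle and its canonical symplectic form -/

section Cotangent

variable (E : Type*) [NormedAddCommGroup E] [NormedSpace ℝ E]
  (Q : Type*) [TopologicalSpace Q] [ChartedSpace E Q] [IsManifold 𝓘(ℝ, E) ∞ Q]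

/-- The cotangent bundle `T*Q` of a manifold `Q` modelled on `E`; its charts are the canonical
cotangent charts `(q, p)` induced by the charts of `Q`. -/
abbrev CotangentBundle : Type _ :=
  TotalSpace (E →L[ℝ] ℝ) (fun q : Q => TangentSpace 𝓘(ℝ, E) q →L[ℝ] Trivial Q ℝ q)

/-- The model with corners of `T*Q`. -/
abbrev cotModel : ModelWithCorners ℝ (E × (E →L[ℝ] ℝ)) (ModelProd E (E →L[ℝ] ℝ)) :=
  𝓘(ℝ, E).prod 𝓘(ℝ, E →L[ℝ] ℝ)

/-- The bilinear form `dq ∧ dp` on `E × E*`, that is `((v, a), (w, b)) ↦ b(v) - a(w)`. -/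
def modelForm : LinearMap.BilinForm ℝ (E × (E →L[ℝ] ℝ)) :=
  LinearMap.mk₂ ℝ
    (fun v w => w.2 v.1 - v.2 w.1)
    (fun v v' w => by simp; ring)
    (fun c v w => by simp; ring)
    (fun v w w' => by simp; ring)
    (fun c v w => by simp; ring)

theorem modelForm_nondegenerate : (modelForm E).Nondegenerate := by
  have key : ∀ v : E × (E →L[ℝ] ℝ),
      (∀ w : E × (E →L[ℝ] ℝ), w.2 v.1 - v.2 w.1 = 0) → v = 0 := by
    intro v hv
    have h1 : v.1 = 0 := by
      by_contra h
      obtain ⟨g, hg⟩ := SeparatingDual.exists_ne_zero (R := ℝ) h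
      apply hg
      simpa using hv (0, g)
    have h2 : v.2 = 0 := by
      ext w
      simpa using hv (w, 0)
    exact Prod.ext h1 h2
  refine ⟨fun v hv => key v fun w => hv w, fun v hv => key v fun w => ?_⟩
  have h : v.2 w.1 - w.2 v.1 = 0 := hv w
  linarith

variable {E Q}

/-- The bundle projection `π_Q : T*Q → Q`. -/
def cotProj (α : CotangentBundle E Q) : Q := α.proj

/-- The canonical symplectic form `ω = ∑ dqⁱ ∧ dpᵢ` on `T*Q`. A tangent vector at `α` is the pair
of its `q`- and `p`-components in the canonical cotangent chart around `α`. -/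
def canonicalForm (α : CotangentBundle E Q) :
    LinearMap.BilinForm ℝ (TangentSpace (cotModel E) α) :=
  modelForm E

theorem canonicalForm_nondegenerate (α : CotangentBundle E Q) :
    (canonicalForm α).Nondegenerate :=
  modelForm_nondegenerate E

instance [FiniteDimensional ℝ E] (α : CotangentBundle E Q) :
    FiniteDimensional ℝ (TangentSpace (cotModel E) α) :=
  inferInstanceAs (FiniteDimensional ℝ (E × (E →L[ℝ] ℝ)))

/-- The Hamiltonian vector field `X_f` on `T*Q`: the vector field with `i_{X_f} ω = df`. -/
def hamiltonianField [FiniteDimensional ℝ E] (f : CotangentBundle E Q → ℝ)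
    (α : CotangentBundle E Q) : TangentSpace (cotModel E) α :=
  ((canonicalForm α).toDual (canonicalForm_nondegenerate α)).symm
    (mfderiv (cotModel E) 𝓘(ℝ, ℝ) f α).toLinearMap

theorem canonicalForm_hamiltonianField [FiniteDimensional ℝ E] (f : CotangentBundle E Q → ℝ)
    (α : CotangentBundle E Q) (w : TangentSpace (cotModel E) α) :
    canonicalForm α (hamiltonianField f α) w = mfderiv (cotModel E) 𝓘(ℝ, ℝ) f α w :=
  LinearMap.congr_fun (LinearEquiv.apply_symm_apply
    ((canonicalForm α).toDual (canonicalForm_nondegenerate α))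
    (mfderiv (cotModel E) 𝓘(ℝ, ℝ) f α).toLinearMap) w

/-- A symplectic map of `T*Q`: a smooth map `ε` with `ε^* ω = ω`. -/
def IsSymplecticMap (ε : CotangentBundle E Q → CotangentBundle E Q) : Prop :=
  ContMDiff (cotModel E) (cotModel E) ∞ ε ∧
    ∀ (α : CotangentBundle E Q) (v w : TangentSpace (cotModel E) α),
      canonicalForm (ε α) (mfderiv (cotModel E) (cotModel E) ε α v)
        (mfderiv (cotModel E) (cotModel E) ε α w) = canonicalForm α v w

/-- The fibre derivative (Legendre transformation) `FL : TQ → T*Q` of a Lagrangian `L`: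
the covector `FL(q, v)` is the derivative at `v` of `L` restricted to `T_q Q`. -/
def legendre (L : TangentBundle 𝓘(ℝ, E) Q → ℝ) (x : TangentBundle 𝓘(ℝ, E) Q) :
    CotangentBundle E Q :=
  ⟨x.proj, fderiv ℝ (fun v : TangentSpace 𝓘(ℝ, E) x.proj => L ⟨x.proj, v⟩) x.snd⟩

/-- The Hessian `∂²L/∂q̇∂q̇` at `v ∈ T_q Q`, applied to `a, b ∈ T_q Q`. -/
def fibreHessian (L : TangentBundle 𝓘(ℝ, E) Q → ℝ) (q : Q)
    (v a b : TangentSpace 𝓘(ℝ, E) q) : ℝ :=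
  fderiv ℝ (fun v' : TangentSpace 𝓘(ℝ, E) q =>
    fderiv ℝ (fun v'' : TangentSpace 𝓘(ℝ, E) q => L ⟨q, v''⟩) v') v a b

/-- The vertical vector `d/dt|₀ (α + t c)` at `α`, for a covector `c` in the fibre of `α`. -/
def vertLift (α : CotangentBundle E Q)
    (c : TangentSpace 𝓘(ℝ, E) α.proj →L[ℝ] Trivial Q ℝ α.proj) :
    TangentSpace (cotModel E) α :=
  (mfderiv 𝓘(ℝ, ℝ) (cotModel E)
    (fun t : ℝ => (⟨α.proj, α.snd + t • c⟩ : CotangentBundle E Q)) 0 (1 : ℝ) :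
      E × (E →L[ℝ] ℝ))

/-- The fibre-preserving map `T*Q → T*Q` with restrictions `F q : T*_q Q → T*_q Q`. -/
def fibreMap
    (F : ∀ q : Q, (TangentSpace 𝓘(ℝ, E) q →L[ℝ] Trivial Q ℝ q) →
      (TangentSpace 𝓘(ℝ, E) q →L[ℝ] Trivial Q ℝ q)) (α : CotangentBundle E Q) :
    CotangentBundle E Q :=
  ⟨α.proj, F α.proj α.snd⟩

/-- The vertical lift `vlift(F)X` of a vector field `X` on `T*Q` along a fibre-preserving map `F`.
The vertical part (with respect to a connection `ver`) of the vector `TF(X(α))` at `F(α)` is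
displaced parallelly to `α` along the straight line in the fibre joining `F(α)` and `α`. -/
def vlift (ver : ∀ α : CotangentBundle E Q,
      TangentSpace (cotModel E) α →L[ℝ] TangentSpace (cotModel E) α)
    (F : ∀ q : Q, (TangentSpace 𝓘(ℝ, E) q →L[ℝ] Trivial Q ℝ q) →
      (TangentSpace 𝓘(ℝ, E) q →L[ℝ] Trivial Q ℝ q))
    (X : ∀ α : CotangentBundle E Q, TangentSpace (cotModel E) α) (α : CotangentBundle E Q) :
    TangentSpace (cotModel E) α :=
  vertLift α (Function.invFun (vertLift (fibreMap F α))
    (ver (fibreMap F α) (mfderiv (cotModel E) (cotModel E) (fibreMap F) α (X α))))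

/-- The cotangent lift `g · α = α ∘ (T_q g)⁻¹ ∈ T*_{gq} Q` of the action of `g` on `Q`. -/
def cotLift {G : Type*} [SMul G Q] (g : G) (α : CotangentBundle E Q) : CotangentBundle E Q :=
  ⟨g • α.proj, α.snd.comp
    (mfderiv 𝓘(ℝ, E) 𝓘(ℝ, E) (fun q : Q => g • q) α.proj).inverse⟩

variable (E Q) in
/-- The orbit space `T*Q/G` of the cotangent lifted action. -/
abbrev OrbitSpace (G : Type*) [SMul G Q] : Type _ :=
  Quot (fun α β : CotangentBundle E Q => ∃ g : G, cotLift g α = β)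

variable (E Q) in
/-- The projection `π_{/G} : T*Q → T*Q/G`. -/
def orbitProj (G : Type*) [SMul G Q] (α : CotangentBundle E Q) : OrbitSpace E Q G :=
  Quot.mk _ α

end Cotangent

/-! ## Linear algebra and distributions -/

/-- The component in `K` of a vector `w ∈ K ⊕ N` (for submodules `K`, `N` with `K ∩ N = 0`), that
is, the projection onto `K` along `N`; the value is `0` for `w ∉ K + N`. -/
def projAlong {V : Type*} [AddCommGroup V] [Module ℝ V] (K N : Submodule ℝ V) (w : V) : V :=
  open Classical in if h : ∃ z ∈ K, w - z ∈ N then h.choose else 0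

theorem projAlong_eq {V : Type*} [AddCommGroup V] [Module ℝ V] {K N : Submodule ℝ V}
    (hKN : Disjoint K N) {w z : V} (hz : z ∈ K) (hw : w - z ∈ N) : projAlong K N w = z := by
  have h : ∃ z ∈ K, w - z ∈ N := ⟨z, hz, hw⟩
  rw [projAlong, dif_pos h]
  have h1 : h.choose - z ∈ K := K.sub_mem h.choose_spec.1 hz
  have h2 : h.choose - z ∈ N := by
    have := N.sub_mem hw h.choose_spec.2
    rwa [sub_sub_sub_cancel_left] at this
  exact sub_eq_zero.mp (Submodule.disjoint_def.mp hKN _ h1 h2)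

section Distributions

variable {E : Type*} [NormedAddCommGroup E] [NormedSpace ℝ E] {H : Type*} [TopologicalSpace H]
  (I : ModelWithCorners ℝ E H) {N : Type*} [TopologicalSpace N] [ChartedSpace H N]

/-- The tangent space at `x` of a submanifold `S ⊂ N`, spanned by the velocities at `t = 0` of the
curves through `x` that lie in `S`. -/
def tangentSubspace (S : Set N) (x : N) : Submodule ℝ (TangentSpace I x) :=
  Submodule.span ℝ {v | ∃ c : ℝ → N, c 0 = x ∧ ContMDiffAt 𝓘(ℝ, ℝ) I ∞ c 0 ∧
    (∀ᶠ t in 𝓝 (0 : ℝ), c t ∈ S) ∧ (mfderiv 𝓘(ℝ, ℝ) I c 0 (1 : ℝ) : E) = v}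

variable [IsManifold I ∞ N]

/-- Smooth vector fields. -/
def IsSmoothField (X : ∀ x : N, TangentSpace I x) : Prop :=
  ContMDiff I I.tangent ∞ (fun x => (⟨x, X x⟩ : TangentBundle I N))

/-- A smooth distribution of constant rank: through every vector of `D` there is a smooth vector
field with values in `D`. -/
def IsSmoothDistribution (D : ∀ x : N, Submodule ℝ (TangentSpace I x)) : Prop :=
  (∃ k : ℕ, ∀ x, Module.finrank ℝ (D x) = k) ∧
    ∀ (x : N), ∀ v ∈ D x, ∃ X : ∀ y : N, TangentSpace I y,
      IsSmoothField I X ∧ (∀ y, X y ∈ D y) ∧ X x = v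

/-- The iterated Lie brackets of smooth vector fields with values in `D`. -/
inductive IteratedBracket (D : ∀ x : N, Submodule ℝ (TangentSpace I x)) :
    (∀ x : N, TangentSpace I x) → Prop
  | of (X : ∀ x : N, TangentSpace I x) (hX : IsSmoothField I X) (hD : ∀ x, X x ∈ D x) :
      IteratedBracket D X
  | bracket (X Y : ∀ x : N, TangentSpace I x) (hX : IteratedBracket D X)
      (hY : IteratedBracket D Y) : IteratedBracket D (VectorField.mlieBracket I X Y)

/-- `D` is completely nonholonomic (bracket-generating). -/
def IsCompletelyNonholonomic (D : ∀ x : N, Submodule ℝ (TangentSpace I x)) : Prop :=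
  ∀ x : N, Submodule.span ℝ {v | ∃ X, IteratedBracket I D X ∧ X x = v} = ⊤

end Distributions

/-! ## Nonholonomic RCH systems with symmetry -/

section System

variable (E : Type*) [NormedAddCommGroup E] [NormedSpace ℝ E] [FiniteDimensional ℝ E]
  (Q : Type*) [TopologicalSpace Q] [ChartedSpace E Q] [IsManifold 𝓘(ℝ, E) ∞ Q]
  (G : Type*) [Group G] [TopologicalSpace G] [MulAction G Q]

/-- A nonholonomic regular controlled Hamiltonian system with symmetry
`(T*Q, G, ω, D, H, F, W)`, together with a control law `u`. -/
structure SymmetricSystem where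
  /-- The constraint distribution `D ⊂ TQ`. -/
  D : ∀ q : Q, Submodule ℝ (TangentSpace 𝓘(ℝ, E) q)
  /-- The Lagrangian. -/
  L : TangentBundle 𝓘(ℝ, E) Q → ℝ
  /-- The Hamiltonian. -/
  H : CotangentBundle E Q → ℝ
  /-- The (fibre-preserving) external force map, fibre by fibre. -/
  F : ∀ q : Q, (TangentSpace 𝓘(ℝ, E) q →L[ℝ] Trivial Q ℝ q) →
    (TangentSpace 𝓘(ℝ, E) q →L[ℝ] Trivial Q ℝ q)
  /-- The control subset. -/
  W : Set (CotangentBundle E Q)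
  /-- The (fibre-preserving) control law, fibre by fibre. -/
  u : ∀ q : Q, (TangentSpace 𝓘(ℝ, E) q →L[ℝ] Trivial Q ℝ q) →
    (TangentSpace 𝓘(ℝ, E) q →L[ℝ] Trivial Q ℝ q)
  /-- The connection on `T*Q → Q` that defines the vertical parts of tangent vectors. -/
  ver : ∀ α : CotangentBundle E Q, TangentSpace (cotModel E) α →L[ℝ] TangentSpace (cotModel E) α
  distribution : IsSmoothDistribution 𝓘(ℝ, E) D
  complete : IsCompletelyNonholonomic 𝓘(ℝ, E) D
  smooth_L : ContMDiff 𝓘(ℝ, E).tangent 𝓘(ℝ, ℝ) ∞ L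
  /-- `L` is hyperregular: `FL` is a diffeomorphism. -/
  hyperregular : ∃ Φ : Diffeomorph 𝓘(ℝ, E).tangent (cotModel E)
    (TangentBundle 𝓘(ℝ, E) Q) (CotangentBundle E Q) ∞, ∀ x, Φ x = legendre L x
  /-- `L` is `D`-regular: its Hessian is nondegenerate on `D`. -/
  regular : ∀ q, ∀ v ∈ D q, ∀ a ∈ D q, (∀ b ∈ D q, fibreHessian L q v a b = 0) → a = 0
  /-- `H` is the Hamiltonian of `L`: `H(FL(v)) = ⟨FL(v), v⟩ - L(v)`. -/
  hamiltonian : ∀ x : TangentBundle 𝓘(ℝ, E) Q,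
    H (legendre L x) = (legendre L x).snd x.snd - L x
  smooth_F : ContMDiff (cotModel E) (cotModel E) ∞ (fibreMap F)
  smooth_u : ContMDiff (cotModel E) (cotModel E) ∞ (fibreMap u)
  u_mem : ∀ α, fibreMap u α ∈ W
  /-- `ver α` is a projection onto the vertical space at `α`. -/
  ver_vertical : ∀ α w, mfderiv (cotModel E) 𝓘(ℝ, E) cotProj α (ver α w) = 0
  ver_eq : ∀ α w, mfderiv (cotModel E) 𝓘(ℝ, E) cotProj α w = 0 → ver α w = w
  /-- The cotangent lifted action is free. -/
  free : ∀ (g : G) (α : CotangentBundle E Q), cotLift g α = α → g = 1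
  /-- The cotangent lifted action is proper. -/
  proper : IsProperMap (fun x : G × CotangentBundle E Q => (cotLift x.1 x.2, x.2))
  D_invariant : ∀ (g : G) (q : Q), ∀ v ∈ D q,
    mfderiv 𝓘(ℝ, E) 𝓘(ℝ, E) (fun q : Q => g • q) q v ∈ D (g • q)
  H_invariant : ∀ (g : G) α, H (cotLift g α) = H α
  F_invariant : ∀ (g : G) α, fibreMap F (cotLift g α) = cotLift g (fibreMap F α)
  W_invariant : ∀ (g : G), ∀ α ∈ W, cotLift g α ∈ W

namespace SymmetricSystem

variable {E Q G}
variable (S : SymmetricSystem E Q G)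

/-- The constraint submanifold `M = FL(D) ⊂ T*Q`. -/
def M : Set (CotangentBundle E Q) :=
  {α | ∃ x : TangentBundle 𝓘(ℝ, E) Q, x.snd ∈ S.D x.proj ∧ legendre S.L x = α}

/-- The tangent space `T_α M`. -/
def TM (α : CotangentBundle E Q) : Submodule ℝ (TangentSpace (cotModel E) α) :=
  tangentSubspace (cotModel E) S.M α

/-- The distribution `ℱ = (Tπ_Q)⁻¹(D)`. -/
def Fdist (α : CotangentBundle E Q) : Submodule ℝ (TangentSpace (cotModel E) α) :=
  (S.D (cotProj α)).comap (mfderiv (cotModel E) 𝓘(ℝ, E) cotProj α).toLinearMap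

/-- The symplectic orthogonal `ℱ^⊥`. -/
def Fperp (α : CotangentBundle E Q) : Submodule ℝ (TangentSpace (cotModel E) α) :=
  (canonicalForm α).orthogonal (S.Fdist α)

/-- The distribution `𝒦 = ℱ ∩ TM` along `M`. -/
def K (α : CotangentBundle E Q) : Submodule ℝ (TangentSpace (cotModel E) α) :=
  S.Fdist α ⊓ S.TM α

/-- The restriction map `τ_𝒦`: the symplectically orthogonal projection onto `𝒦`. -/
def tauK (α : CotangentBundle E Q) (w : TangentSpace (cotModel E) α) :
    TangentSpace (cotModel E) α :=
  projAlong (S.K α) ((canonicalForm α).orthogonal (S.K α)) w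

/-- `X` is the nonholonomic dynamical vector field `X_𝒦` on `M`: it takes values in `𝒦` and
satisfies the distributional Hamiltonian equation `i_X ω_𝒦 = dH_𝒦`. -/
def IsNonholonomicField (X : ∀ α : CotangentBundle E Q, TangentSpace (cotModel E) α) : Prop :=
  ∀ α ∈ S.M, X α ∈ S.K α ∧
    ∀ v ∈ S.K α, canonicalForm α (X α) v = mfderiv (cotModel E) 𝓘(ℝ, ℝ) S.H α v

/-- The vector field `F_𝒦 = τ_𝒦 · vlift(F)X_H`. -/
def FK (α : CotangentBundle E Q) : TangentSpace (cotModel E) α :=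
  S.tauK α (vlift S.ver S.F (hamiltonianField S.H) α)

/-- The vector field `u_𝒦 = τ_𝒦 · vlift(u)X_H`. -/
def uK (α : CotangentBundle E Q) : TangentSpace (cotModel E) α :=
  S.tauK α (vlift S.ver S.u (hamiltonianField S.H) α)

/-- The dynamical vector field `X_𝒦 + F_𝒦 + u_𝒦` of the distributional RCH system. -/
def dynamicalField (XK : ∀ α : CotangentBundle E Q, TangentSpace (cotModel E) α)
    (α : CotangentBundle E Q) : TangentSpace (cotModel E) α :=
  XK α + S.FK α + S.uK α

/-- A one-form on `Q` as a map `Q → T*Q`. -/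
def _root_.NonholonomicRCH.sectionMap
    (γ : ∀ q : Q, TangentSpace 𝓘(ℝ, E) q →L[ℝ] Trivial Q ℝ q) (q : Q) : CotangentBundle E Q :=
  ⟨q, γ q⟩

variable (EG : Type*) [NormedAddCommGroup EG] [NormedSpace ℝ EG] [ChartedSpace EG G]

variable (G) in
/-- The tangent space at `α` of the `G`-orbit through `α`. -/
def _root_.NonholonomicRCH.orbitTangent (α : CotangentBundle E Q) :
    Submodule ℝ (TangentSpace (cotModel E) α) :=
  show Submodule ℝ (E × (E →L[ℝ] ℝ)) from
    LinearMap.range (mfderiv 𝓘(ℝ, EG) (cotModel E) (fun g : G => cotLift g α) 1).toLinearMap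

/-- The distribution `𝒰 = {u ∈ 𝒦 | ω_𝒦(u, v) = 0 for all v ∈ 𝒱 ∩ 𝒦}`. -/
def U (α : CotangentBundle E Q) : Submodule ℝ (TangentSpace (cotModel E) α) :=
  S.K α ⊓ (canonicalForm α).orthogonal (orbitTangent G EG α ⊓ S.K α)

variable (EB : Type*) [NormedAddCommGroup EB] [NormedSpace ℝ EB]
  [ChartedSpace EB (OrbitSpace E Q G)]

variable (G) in
/-- The tangent map `T_α π_{/G} : T_α T*Q → T_{π(α)} (T*Q/G)`. -/
def _root_.NonholonomicRCH.tangentOrbitProj (α : CotangentBundle E Q) :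
    TangentSpace (cotModel E) α →ₗ[ℝ] TangentSpace 𝓘(ℝ, EB) (orbitProj E Q G α) :=
  (mfderiv (cotModel E) 𝓘(ℝ, EB) (orbitProj E Q G) α).toLinearMap

/-- The fibre over `π_{/G}(α)`, `α ∈ M`, of the reduced distribution `𝒦̄ = Tπ_{/G}(𝒰)`; by
invariance it depends on the orbit of `α` only. -/
def Kbar (α : CotangentBundle E Q) :
    Submodule ℝ (TangentSpace 𝓘(ℝ, EB) (orbitProj E Q G α)) :=
  (S.U EG α).map (tangentOrbitProj G EB α)

/-- The fibre over `π_{/G}(α)`, `α ∈ M`, of `TM̄ = Tπ_{/G}(TM)`. -/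
def TMbar (α : CotangentBundle E Q) :
    Submodule ℝ (TangentSpace 𝓘(ℝ, EB) (orbitProj E Q G α)) :=
  (S.TM α).map (tangentOrbitProj G EB α)

/-- The fibre over `π_{/G}(α)`, `α ∈ M`, of `ℱ̄^⊥ = Tπ_{/G}(ℱ^⊥)`. -/
def Fbarperp (α : CotangentBundle E Q) :
    Submodule ℝ (TangentSpace 𝓘(ℝ, EB) (orbitProj E Q G α)) :=
  (S.Fperp α).map (tangentOrbitProj G EB α)

/-- The restriction map `τ_𝒦̄` at `π_{/G}(α)`, `α ∈ M`: the projection of `𝒦̄ ⊕ ℱ̄^⊥` onto `𝒦̄`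
along `ℱ̄^⊥`, induced by the decomposition of `T(T*Q/G)` along `M̄` into `TM̄ ⊕ ℱ̄^⊥`. -/
def tauKbar (α : CotangentBundle E Q) (w : TangentSpace 𝓘(ℝ, EB) (orbitProj E Q G α)) :
    TangentSpace 𝓘(ℝ, EB) (orbitProj E Q G α) :=
  projAlong (S.Kbar EG EB α) (S.Fbarperp EB α) w

/-- The standing conditions for the (reduced) distributional two-forms to be nondegenerate:
admissibility `dim M = rank ℱ`, compatibility `TM ∩ ℱ^⊥ = 0`, and compatibility
`TM̄ ∩ ℱ̄^⊥ = 0` on the reduced constraint submanifold; moreover `T*Q/G` is a smooth manifold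
such that `π_{/G}` is a (surjective) submersion. -/
structure IsReducible : Prop where
  smooth_proj : ContMDiff (cotModel E) 𝓘(ℝ, EB) ∞ (orbitProj E Q G)
  submersion : ∀ α, Function.Surjective (tangentOrbitProj (E := E) (Q := Q) G EB α)
  admissible : ∀ α ∈ S.M, Module.finrank ℝ (S.TM α) = Module.finrank ℝ (S.Fdist α)
  compatible : ∀ α ∈ S.M, Disjoint (S.TM α) (S.Fperp α)
  compatible_bar : ∀ α ∈ S.M, Disjoint (S.TMbar EB α) (S.Fbarperp EB α)

/-- A nonholonomic reduced distributional RCH system: the reduced distribution `𝒦̄` carries the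
distributional two-form `ω_𝒦̄` with `π_{/G}^* ω_𝒦̄ = ω_𝒰`, and `X_𝒦̄` is the vector field on `M̄`
with values in `𝒦̄` that satisfies `i_{X_𝒦̄} ω_𝒦̄ = dh_𝒦̄`. -/
structure ReducedSystem where
  /-- The reduced Hamiltonian. -/
  h : OrbitSpace E Q G → ℝ
  /-- The reduced distributional two-form; only its values on `𝒦̄` matter. -/
  form : ∀ y : OrbitSpace E Q G, LinearMap.BilinForm ℝ (TangentSpace 𝓘(ℝ, EB) y)
  /-- The nonholonomic reduced dynamical vector field; only its values on `M̄` matter. -/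
  X : ∀ y : OrbitSpace E Q G, TangentSpace 𝓘(ℝ, EB) y
  smooth_h : ContMDiff 𝓘(ℝ, EB) 𝓘(ℝ, ℝ) ∞ h
  h_proj : ∀ α, h (orbitProj E Q G α) = S.H α
  form_proj : ∀ α ∈ S.M, ∀ v ∈ S.U EG α, ∀ w ∈ S.U EG α,
    form (orbitProj E Q G α) (tangentOrbitProj G EB α v) (tangentOrbitProj G EB α w) =
      canonicalForm α v w
  X_mem : ∀ α ∈ S.M, X (orbitProj E Q G α) ∈ S.Kbar EG EB α
  X_eq : ∀ α ∈ S.M, ∀ w ∈ S.Kbar EG EB α,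
    form (orbitProj E Q G α) (X (orbitProj E Q G α)) w =
      mfderiv 𝓘(ℝ, EB) 𝓘(ℝ, ℝ) h (orbitProj E Q G α) w

end SymmetricSystem

end System

end

end NonholonomicRCH

set_option linter.unusedSectionVars false

/-! The two equations have the same sides, interchanged, base points included. Since `λ̄ = γ̄ ∘
π_Q`, the chain rule gives `Tλ̄ · X̃ · ε = Tγ̄ · X̃^ε`, whatever the vector `X̃(ε(α))` is. It
remains to see that `τ_𝒦̄ · Tε̄ · X_{h∘ε̄} = X_𝒦̄ · ε̄` holds identically on `M`. As `h ∘ ε̄ = H ∘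
ε` and `ε` is symplectic, `Tε · X_{H∘ε} = X_H · ε`, so the claim becomes `τ_𝒦̄ · Tπ_{/G} · X_H =
X_𝒦̄ · π_{/G}` along `M` (`ReducedSystem.tauKbar_hamiltonianField`).

For this, admissibility and compatibility give `T(T*Q) = TM ⊕ ℱ^⊥` along `M`; let `Y` be the
`TM`-component of `X_H`. Hamilton's equation `∂H/∂p = q̇` puts `X_H` in `ℱ` along `M = FL(D)`, and
`ℱ^⊥ ⊆ ℱ`, hence `Y ∈ 𝒦`. On `𝒦` the forms `ω(Y, ·)` and `dH` agree, and `H` is invariant, hence `Y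
∈ 𝒰`. Thus `Tπ_{/G} Y` is the `𝒦̄`-component of `Tπ_{/G} X_H`. Finally let `x ∈ 𝒰` be a lift of
`X_𝒦̄`. Then `x - Y` is orthogonal to `𝒰`, which is the orthogonal of `𝒱 ∩ 𝒦` inside `𝒦`; as `ω_𝒦`
is nondegenerate, `x - Y ∈ 𝒱`, and `Tπ_{/G}` kills it. -/

namespace NonholonomicRCH

/-! ### Derivatives of bundle projections and fibre inclusions -/

section FibreBundles

variable {E : Type*} [NormedAddCommGroup E] [NormedSpace ℝ E]
  {B : Type*} [TopologicalSpace B] [ChartedSpace E B]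
  {F : Type*} [NormedAddCommGroup F] [NormedSpace ℝ F]
  {V : B → Type*} [TopologicalSpace (TotalSpace F V)] [∀ b, TopologicalSpace (V b)]
  [FiberBundle F V]

/-- In bundle charts, the tangent map of a bundle projection is the first projection. -/
theorem mfderiv_totalSpace_proj (x : TotalSpace F V)
    (w : TangentSpace (𝓘(ℝ, E).prod 𝓘(ℝ, F)) x) :
    mfderiv (𝓘(ℝ, E).prod 𝓘(ℝ, F)) 𝓘(ℝ, E) (TotalSpace.proj : TotalSpace F V → B) x w =
      (show E × F from w).1 := by
  have hd : MDifferentiableAt (𝓘(ℝ, E).prod 𝓘(ℝ, F)) 𝓘(ℝ, E)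
      (TotalSpace.proj : TotalSpace F V → B) x :=
    (contMDiff_proj V (n := 1)).mdifferentiableAt one_ne_zero
  have hderiv : HasFDerivAt (writtenInExtChartAt (𝓘(ℝ, E).prod 𝓘(ℝ, F)) 𝓘(ℝ, E) x
      (TotalSpace.proj : TotalSpace F V → B)) (ContinuousLinearMap.fst ℝ E F)
      (extChartAt (𝓘(ℝ, E).prod 𝓘(ℝ, F)) x x) := by
    -- The chart expression of the projection is `Prod.fst` on the chart target only; that is a
    -- neighbourhood, which suffices for the derivative.
    refine HasFDerivAt.congr_of_eventuallyEq (f := Prod.fst) hasFDerivAt_fst ?_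
    filter_upwards [extChartAt_target_mem_nhds (I := 𝓘(ℝ, E).prod 𝓘(ℝ, F)) x] with y hy
    have h2 := FiberBundle.chartedSpace_chartAt_symm_fst (F := F) (E := V) x y
      (by simpa [extChartAt, OpenPartialHomeomorph.extend] using! hy)
    have h1 : y.1 ∈ (chartAt E x.proj).target := by
      rw [FiberBundle.extChartAt_target] at hy
      simpa using hy.1.1
    have h3 : chartAt E x.proj ((chartAt (ModelProd E F) x).symm y).proj = y.1 := by
      rw [h2]; exact (chartAt E x.proj).right_inv h1
    exact h3
  rw [hd.mfderiv]
  have := hderiv.hasFDerivWithinAt (s := Set.range (𝓘(ℝ, E).prod 𝓘(ℝ, F)))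
  rw [this.fderivWithin ((𝓘(ℝ, E).prod 𝓘(ℝ, F)).uniqueDiffWithinAt_image)]
  rfl

/-- A map into a single fibre, which is the identity in the bundle chart, has the second inclusion
as derivative. -/
theorem hasMFDerivAt_fibre_inclusion (b : B) (i : F → V b)
    (hi : ∀ c, (trivializationAt F V b ⟨b, i c⟩).2 = c) (c : F) :
    HasMFDerivAt 𝓘(ℝ, F) (𝓘(ℝ, E).prod 𝓘(ℝ, F)) (fun c => (⟨b, i c⟩ : TotalSpace F V)) c
      (ContinuousLinearMap.inr ℝ E F) := by
  have hs : ContMDiff 𝓘(ℝ, F) (𝓘(ℝ, E).prod 𝓘(ℝ, F)) 1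
      (fun c => (⟨b, i c⟩ : TotalSpace F V)) := by
    intro c
    rw [Bundle.contMDiffAt_totalSpace]
    exact ⟨contMDiffAt_const, by simp only [hi]; exact contMDiffAt_id⟩
  refine ⟨hs.continuous.continuousAt, ?_⟩
  refine HasFDerivAt.hasFDerivWithinAt ?_
  have : writtenInExtChartAt 𝓘(ℝ, F) (𝓘(ℝ, E).prod 𝓘(ℝ, F)) c
      (fun c => (⟨b, i c⟩ : TotalSpace F V)) = fun c => (chartAt E b b, c) := by
    funext c'
    have h1 : (trivializationAt F V b ⟨b, i c'⟩).1 = b :=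
      (trivializationAt F V b).coe_fst' (mem_baseSet_trivializationAt F V b)
    have h2 : chartAt E b (trivializationAt F V b ⟨b, i c'⟩).1 = chartAt E b b := by rw [h1]
    rw [writtenInExtChartAt, FiberBundle.extChartAt]
    exact Prod.ext h2 (hi c')
  rw [this]
  exact (hasFDerivAt_prodMk_right _ _)

theorem contMDiff_fibre_inclusion (b : B) (i : F → V b)
    (hi : ∀ c, (trivializationAt F V b ⟨b, i c⟩).2 = c) :
    ContMDiff 𝓘(ℝ, F) (𝓘(ℝ, E).prod 𝓘(ℝ, F)) ∞ (fun c => (⟨b, i c⟩ : TotalSpace F V)) := by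
  intro c
  rw [Bundle.contMDiffAt_totalSpace]
  exact ⟨contMDiffAt_const, by simp only [hi]; exact contMDiffAt_id⟩

end FibreBundles

/-! ### Canonical coordinates on the tangent and cotangent bundles -/

section Cotangent

variable {E : Type*} [NormedAddCommGroup E] [NormedSpace ℝ E]
  {Q : Type*} [TopologicalSpace Q] [ChartedSpace E Q] [IsManifold 𝓘(ℝ, E) ∞ Q]

theorem trivializationAt_tangent_self (q : Q) (v : E) :
    (trivializationAt E (TangentSpace 𝓘(ℝ, E) : Q → Type _) q ⟨q, v⟩).2 = v :=
  (tangentBundleCore 𝓘(ℝ, E) Q).coordChange_self (achart E q) q (mem_achart_source E q) v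

/-- The coordinate change from a chart to itself is the identity, so a covector over the centre of
the trivialization is its own coordinate. -/
theorem trivializationAt_cotangent_self (q : Q) (p : E →L[ℝ] ℝ) :
    (trivializationAt (E →L[ℝ] ℝ)
      (fun q : Q => TangentSpace 𝓘(ℝ, E) q →L[ℝ] Trivial Q ℝ q) q ⟨q, p⟩).2 = p := by
  rw [hom_trivializationAt_apply]
  ext v
  have h := TangentBundle.symmL_trivializationAt_eq_core (I := 𝓘(ℝ, E))
    (mem_chart_source E q)
  have h' := (tangentBundleCore 𝓘(ℝ, E) Q).coordChange_self (achart E q) q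
    (mem_achart_source E q) v
  simp only [ContinuousLinearMap.inCoordinates, h]
  simp [-tangentBundleCore_coordChange]
  exact congrArg p h'

/-- The tangent map of `π_Q` reads off the `q`-component. -/
theorem mfderiv_cotProj (α : CotangentBundle E Q) (w : TangentSpace (cotModel E) α) :
    mfderiv (cotModel E) 𝓘(ℝ, E) (cotProj : CotangentBundle E Q → Q) α w =
      (show E × (E →L[ℝ] ℝ) from w).1 :=
  mfderiv_totalSpace_proj α w

theorem hasMFDerivAt_cotangent_fibre (q : Q) (p : E →L[ℝ] ℝ) :
    HasMFDerivAt 𝓘(ℝ, E →L[ℝ] ℝ) (cotModel E)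
      (fun c : E →L[ℝ] ℝ => (⟨q, c⟩ : CotangentBundle E Q)) p
      (ContinuousLinearMap.inr ℝ E (E →L[ℝ] ℝ)) :=
  hasMFDerivAt_fibre_inclusion (F := (E →L[ℝ] ℝ))
    (V := (fun q : Q => TangentSpace 𝓘(ℝ, E) q →L[ℝ] Trivial Q ℝ q))
    q (fun c => c) (trivializationAt_cotangent_self q) p

theorem hasMFDerivAt_tangent_fibre (q : Q) (v : E) :
    HasMFDerivAt 𝓘(ℝ, E) 𝓘(ℝ, E).tangent
      (fun v : E => (⟨q, v⟩ : TangentBundle 𝓘(ℝ, E) Q)) v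
      (ContinuousLinearMap.inr ℝ E E) :=
  hasMFDerivAt_fibre_inclusion (F := E)
    (V := (TangentSpace 𝓘(ℝ, E) : Q → Type _))
    q (fun c => c) (trivializationAt_tangent_self q) v

theorem contMDiff_tangent_fibre (q : Q) :
    ContMDiff 𝓘(ℝ, E) 𝓘(ℝ, E).tangent ∞
      (fun v : E => (⟨q, v⟩ : TangentBundle 𝓘(ℝ, E) Q)) :=
  contMDiff_fibre_inclusion (F := E)
    (V := (TangentSpace 𝓘(ℝ, E) : Q → Type _))
    q (fun c => c) (trivializationAt_tangent_self q)

end Cotangent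

/-! ### Legendre transformation and Hamilton's equation for the velocity -/

section Legendre

variable {E : Type*} [NormedAddCommGroup E] [NormedSpace ℝ E] [FiniteDimensional ℝ E]
  {Q : Type*} [TopologicalSpace Q] [ChartedSpace E Q] [IsManifold 𝓘(ℝ, E) ∞ Q]

/-- The Legendre transformation between the fibres over `q`, in the model space. -/
noncomputable def fibreLegendre (L : TangentBundle 𝓘(ℝ, E) Q → ℝ) (q : Q) (v : E) : E →L[ℝ] ℝ :=
  fderiv ℝ (fun v : E => L ⟨q, v⟩) v

theorem contDiff_lagrangian_fibre {L : TangentBundle 𝓘(ℝ, E) Q → ℝ}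
    (hL : ContMDiff 𝓘(ℝ, E).tangent 𝓘(ℝ, ℝ) ∞ L) (q : Q) :
    ContDiff ℝ ∞ (fun v : E => L ⟨q, v⟩) :=
  contMDiff_iff_contDiff.mp (hL.comp (contMDiff_tangent_fibre q))

theorem differentiable_fibreLegendre {L : TangentBundle 𝓘(ℝ, E) Q → ℝ}
    (hL : ContMDiff 𝓘(ℝ, E).tangent 𝓘(ℝ, ℝ) ∞ L) (q : Q) :
    Differentiable ℝ (fibreLegendre L q) :=
  ((contDiff_lagrangian_fibre hL q).fderiv_right (m := 1) (by norm_cast)).differentiable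
    one_ne_zero

/-- If the Legendre transformation is a diffeomorphism, so are its restrictions to the fibres, at
the infinitesimal level. -/
theorem surjective_fderiv_fibreLegendre {L : TangentBundle 𝓘(ℝ, E) Q → ℝ}
    (hL : ContMDiff 𝓘(ℝ, E).tangent 𝓘(ℝ, ℝ) ∞ L)
    (Φ : Diffeomorph 𝓘(ℝ, E).tangent (cotModel E)
      (TangentBundle 𝓘(ℝ, E) Q) (CotangentBundle E Q) ∞) (hΦ : ∀ x, Φ x = legendre L x)
    (q : Q) (v : E) : Function.Surjective (fderiv ℝ (fibreLegendre L q) v) := by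
  -- Differentiating `Φ(q, v) = (q, ℓ(v))` along the fibre, with `ℓ` the fibre Legendre map, gives
  -- `TΦ(0, a) = (0, Dℓ(a))`, and `TΦ` is injective.
  have hinj : Function.Injective (fderiv ℝ (fibreLegendre L q) v) := by
    have h1 : HasMFDerivAt 𝓘(ℝ, E) (cotModel E)
        (fun v : E => Φ (⟨q, v⟩ : TangentBundle 𝓘(ℝ, E) Q)) v _ :=
      HasMFDerivAt.comp (M := E) (I := 𝓘(ℝ, E))
        (f := fun v : E => (⟨q, v⟩ : TangentBundle 𝓘(ℝ, E) Q)) v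
        ((Φ.mdifferentiable (by simp)) (⟨q, v⟩ : TangentBundle 𝓘(ℝ, E) Q)).hasMFDerivAt
        (hasMFDerivAt_tangent_fibre q v)
    have h2 : HasMFDerivAt 𝓘(ℝ, E) (cotModel E)
        (fun v : E => (⟨q, fibreLegendre (E := E) L q v⟩ : CotangentBundle E Q)) v _ :=
      HasMFDerivAt.comp (M := E) (I := 𝓘(ℝ, E)) (M' := E →L[ℝ] ℝ) (I' := 𝓘(ℝ, E →L[ℝ] ℝ))
        (f := fibreLegendre L q) v (hasMFDerivAt_cotangent_fibre q (fibreLegendre L q v))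
        (differentiable_fibreLegendre hL q v).hasFDerivAt.hasMFDerivAt
    have h3 : (fun v : E => Φ (⟨q, v⟩ : TangentBundle 𝓘(ℝ, E) Q)) =
        fun v : E => (⟨q, fibreLegendre (E := E) L q v⟩ : CotangentBundle E Q) :=
      funext fun v => hΦ _
    rw [h3] at h1
    have h4 := hasMFDerivAt_unique h1 h2
    have hΦinj : Function.Injective (mfderiv 𝓘(ℝ, E).tangent (cotModel E) Φ
        (⟨q, v⟩ : TangentBundle 𝓘(ℝ, E) Q)) :=
      (Φ.mfderivToContinuousLinearEquiv (by simp) _).injective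
    intro a b hab
    have h5 := DFunLike.congr_fun h4 a
    have h6 := DFunLike.congr_fun h4 b
    have h7 : mfderiv 𝓘(ℝ, E).tangent (cotModel E) Φ
        (⟨q, v⟩ : TangentBundle 𝓘(ℝ, E) Q) ((0, a) : E × E) =
        mfderiv 𝓘(ℝ, E).tangent (cotModel E) Φ
        (⟨q, v⟩ : TangentBundle 𝓘(ℝ, E) Q) ((0, b) : E × E) := by
      refine h5.trans (Eq.trans ?_ h6.symm)
      exact congrArg (fun c => ((0, c) : E × (E →L[ℝ] ℝ))) hab
    exact congrArg Prod.snd (hΦinj h7)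
  have hdim : Module.finrank ℝ E = Module.finrank ℝ (E →L[ℝ] ℝ) := by
    rw [← (LinearMap.toContinuousLinearMap : (E →ₗ[ℝ] ℝ) ≃ₗ[ℝ] (E →L[ℝ] ℝ)).finrank_eq]
    exact Subspace.dual_finrank_eq.symm
  exact (LinearMap.injective_iff_surjective_of_finrank_eq_finrank
    (f := (fderiv ℝ (fibreLegendre L q) v).toLinearMap) hdim).mp hinj

/-- Hamilton's equation `∂H/∂p = q̇` at the points `FL(q, v)`. -/
theorem mfderiv_hamiltonian_fibre {L : TangentBundle 𝓘(ℝ, E) Q → ℝ}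
    (hL : ContMDiff 𝓘(ℝ, E).tangent 𝓘(ℝ, ℝ) ∞ L)
    (Φ : Diffeomorph 𝓘(ℝ, E).tangent (cotModel E)
      (TangentBundle 𝓘(ℝ, E) Q) (CotangentBundle E Q) ∞) (hΦ : ∀ x, Φ x = legendre L x)
    {H : CotangentBundle E Q → ℝ} (hH : MDifferentiable (cotModel E) 𝓘(ℝ, ℝ) H)
    (hHL : ∀ x : TangentBundle 𝓘(ℝ, E) Q,
      H (legendre L x) = (legendre L x).snd x.snd - L x)
    (x : TangentBundle 𝓘(ℝ, E) Q) (c : E →L[ℝ] ℝ) :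
    mfderiv (cotModel E) 𝓘(ℝ, ℝ) H (legendre L x) ((0, c) : E × (E →L[ℝ] ℝ)) = c x.snd := by
  obtain ⟨q, (v : E)⟩ := x
  -- With `c = Dℓ(w)`, the value `dH(0, c)` is the derivative along `w` of `ℓ(v)(v) - L(v)`; there
  -- `ℓ(v)(w)` cancels `dL(w)`, and `Dℓ(w)(v) = c(v)` remains.
  obtain ⟨w, rfl⟩ := surjective_fderiv_fibreLegendre hL Φ hΦ q v c
  have hℓ := (differentiable_fibreLegendre hL q v).hasFDerivAt
  have hLq : HasFDerivAt (fun v : E => L ⟨q, v⟩) (fibreLegendre L q v) v :=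
    ((contDiff_lagrangian_fibre hL q).differentiable (by simp) v).hasFDerivAt
  have h1 : HasMFDerivAt 𝓘(ℝ, E →L[ℝ] ℝ) 𝓘(ℝ, ℝ)
      (fun c : E →L[ℝ] ℝ => H (⟨q, c⟩ : CotangentBundle E Q)) (fibreLegendre L q v) _ :=
    HasMFDerivAt.comp (M := E →L[ℝ] ℝ) (I := 𝓘(ℝ, E →L[ℝ] ℝ))
      (f := fun c : E →L[ℝ] ℝ => (⟨q, c⟩ : CotangentBundle E Q)) _
      (hH (⟨q, fibreLegendre (E := E) L q v⟩ : CotangentBundle E Q)).hasMFDerivAt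
      (hasMFDerivAt_cotangent_fibre q (fibreLegendre L q v))
  have h2 := (hasMFDerivAt_iff_hasFDerivAt.mp h1).comp v hℓ
  have h3 : HasFDerivAt (fun v : E => fibreLegendre L q v v - L ⟨q, v⟩) _ v :=
    (hℓ.clm_apply (hasFDerivAt_id v)).sub hLq
  have h4 : ((fun c : E →L[ℝ] ℝ => H (⟨q, c⟩ : CotangentBundle E Q)) ∘ fibreLegendre L q) =
      fun v : E => fibreLegendre L q v v - L ⟨q, v⟩ := funext fun v => hHL ⟨q, v⟩
  rw [h4] at h2
  have h5 := DFunLike.congr_fun (h2.unique h3) w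
  refine Eq.trans h5 ?_
  simp
  rfl

end Legendre

/-! ### Orthogonal complements for a reflexive bilinear form -/

section LinearAlgebra

variable {V : Type*} [AddCommGroup V] [Module ℝ V] [FiniteDimensional ℝ V]
  {B : LinearMap.BilinForm ℝ V}

/-- Nondegeneracy gives `dim F^⊥ = dim V - dim F`, so the dimensions of the disjoint subspaces `T`
and `F^⊥` add up to `dim V`. -/
theorem sup_orthogonal_eq_top_of_finrank_eq (hB : B.Nondegenerate)
    {T F : Submodule ℝ V} (hdim : Module.finrank ℝ T = Module.finrank ℝ F)
    (hd : Disjoint T (B.orthogonal F)) : T ⊔ B.orthogonal F = ⊤ := by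
  apply Submodule.eq_top_of_finrank_eq
  have h1 := Submodule.finrank_sup_add_finrank_inf_eq T (B.orthogonal F)
  rw [hd.eq_bot, finrank_bot, LinearMap.BilinForm.finrank_orthogonal hB] at h1
  have := Submodule.finrank_le F
  omega

/-- If `F^⊥ ⊆ F` and `V = T ⊕ F^⊥`, then `B` is nondegenerate on `F ∩ T`. -/
theorem eq_zero_of_mem_inf_of_forall (hrefl : B.IsRefl) {T F : Submodule ℝ V}
    (hF : B.orthogonal F ≤ F) (hd : Disjoint T (B.orthogonal F)) (htop : T ⊔ B.orthogonal F = ⊤)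
    {d : V} (hdm : d ∈ F ⊓ T) (hz : ∀ v ∈ F ⊓ T, B d v = 0) : d = 0 := by
  -- It suffices that `d ∈ F^⊥`. Split `f ∈ F` along `T ⊕ F^⊥`: the `T`-part stays in `F` because
  -- `F^⊥ ⊆ F`, so `d` is orthogonal to both parts.
  refine Submodule.disjoint_def.mp hd d hdm.2 fun f hf => ?_
  obtain ⟨y, hy, z, hzF, rfl⟩ := Submodule.mem_sup.mp (htop ▸ Submodule.mem_top : f ∈ _)
  have hyF : y ∈ F := by simpa using F.sub_mem hf (hF hzF)
  have h1 : B d y = 0 := hz y ⟨hyF, hy⟩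
  have h2 : B d z = 0 := hzF d hdm.1
  apply hrefl
  simp [h1, h2]

/-- In a subspace `K` on which `B` is nondegenerate, the double orthogonal of `W ∩ K` is
`W ∩ K`. -/
theorem mem_of_forall_inf_orthogonal (hB : B.Nondegenerate) (hrefl : B.IsRefl)
    {K W : Submodule ℝ V} (hK : ∀ d ∈ K, (∀ v ∈ K, B d v = 0) → d = 0) {d : V} (hd : d ∈ K)
    (hz : ∀ v ∈ K ⊓ B.orthogonal (W ⊓ K), B d v = 0) : d ∈ W := by
  -- The orthogonal of `K^⊥ + W ∩ K` is `K ∩ (W ∩ K)^⊥`, to which `d` is orthogonal; the double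
  -- orthogonal of the sum is the sum itself. Its `K^⊥`-part then vanishes, lying in `K ∩ K^⊥`.
  have h1 : d ∈ B.orthogonal K ⊔ W ⊓ K := by
    rw [← LinearMap.BilinForm.orthogonal_orthogonal hB hrefl (B.orthogonal K ⊔ W ⊓ K)]
    intro v hv
    apply hrefl
    apply hz
    refine ⟨?_, fun w hw => hv w (Submodule.mem_sup_right hw)⟩
    rw [← LinearMap.BilinForm.orthogonal_orthogonal hB hrefl K]
    exact fun w hw => hv w (Submodule.mem_sup_left hw)
  obtain ⟨a, ha, b, hb, rfl⟩ := Submodule.mem_sup.mp h1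
  have haK : a ∈ K := by simpa using K.sub_mem hd hb.2
  have ha0 : a = 0 := hK a haK fun v hv => hrefl _ _ (ha v hv)
  simpa [ha0] using hb.1

end LinearAlgebra

/-! ### Symplectic maps and Hamiltonian fields -/

section Symplectic

variable {E : Type*} [NormedAddCommGroup E] [NormedSpace ℝ E]
  {Q : Type*} [TopologicalSpace Q] [ChartedSpace E Q] [IsManifold 𝓘(ℝ, E) ∞ Q]

theorem canonicalForm_apply (α : CotangentBundle E Q) (v w : E × (E →L[ℝ] ℝ)) :
    canonicalForm α v w = w.2 v.1 - v.2 w.1 := rfl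

theorem canonicalForm_isRefl (α : CotangentBundle E Q) : (canonicalForm α).IsRefl := by
  intro v w h
  have h1 := canonicalForm_apply α v w
  have h2 := canonicalForm_apply α w v
  rw [h2]
  rw [h1] at h
  linarith

/-- A symplectic map `ε` intertwines `X_{H ∘ ε}` and `X_H`. -/
theorem IsSymplecticMap.mfderiv_hamiltonianField [FiniteDimensional ℝ E]
    {ε : CotangentBundle E Q → CotangentBundle E Q} (hε : IsSymplecticMap ε)
    {H : CotangentBundle E Q → ℝ} (hH : MDifferentiable (cotModel E) 𝓘(ℝ, ℝ) H)
    (α : CotangentBundle E Q) :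
    mfderiv (cotModel E) (cotModel E) ε α (hamiltonianField (fun β => H (ε β)) α) =
      hamiltonianField H (ε α) := by
  have hεd : MDifferentiableAt (cotModel E) (cotModel E) ε α :=
    hε.1.mdifferentiable (by simp) α
  have hinj : Function.Injective (mfderiv (cotModel E) (cotModel E) ε α).toLinearMap := by
    rw [← LinearMap.ker_eq_bot, LinearMap.ker_eq_bot']
    intro v hv
    refine (canonicalForm_nondegenerate α).1 v fun w => ?_
    rw [← hε.2 α v w]
    have hv' : mfderiv (cotModel E) (cotModel E) ε α v = 0 := hv
    rw [hv', map_zero, LinearMap.zero_apply]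
  have hsurj : Function.Surjective (mfderiv (cotModel E) (cotModel E) ε α).toLinearMap :=
    (LinearMap.injective_iff_surjective_of_finrank_eq_finrank rfl).mp hinj
  rw [← sub_eq_zero]
  refine (canonicalForm_nondegenerate (ε α)).1 _ fun w => ?_
  -- `Tε` is injective since it preserves a nondegenerate form, hence bijective by dimension; every
  -- test vector at `ε(α)` is therefore some `Tε(w)`.
  obtain ⟨w, rfl⟩ := hsurj w
  change canonicalForm (ε α) _ (mfderiv (cotModel E) (cotModel E) ε α w) = 0
  rw [map_sub, LinearMap.sub_apply, hε.2, canonicalForm_hamiltonianField,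
    canonicalForm_hamiltonianField]
  exact sub_eq_zero.mpr (DFunLike.congr_fun (mfderiv_comp α (hH (ε α)) hεd) w)

end Symplectic

/-! ### Invariant maps and orbit directions -/

section OrbitSpace

variable {E : Type*} [NormedAddCommGroup E] [NormedSpace ℝ E]
  {Q : Type*} [TopologicalSpace Q] [ChartedSpace E Q]
  {G : Type*} [Group G] [MulAction G Q]

theorem cotLift_one (α : CotangentBundle E Q) : cotLift (1 : G) α = α := by
  have key : ∀ f : Q → Q, f = id → (⟨f α.proj, α.snd.comp
      (mfderiv 𝓘(ℝ, E) 𝓘(ℝ, E) f α.proj).inverse⟩ : CotangentBundle E Q) = α := by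
    rintro _ rfl
    rw [mfderiv_id]
    have : (ContinuousLinearMap.id ℝ (TangentSpace 𝓘(ℝ, E) α.proj)).inverse =
        ContinuousLinearMap.id ℝ (TangentSpace 𝓘(ℝ, E) α.proj) :=
      ContinuousLinearMap.inverse_id
    exact congrArg (fun c => (⟨α.proj, α.snd.comp c⟩ : CotangentBundle E Q)) this
  exact key _ (funext fun q => one_smul G q)

theorem orbitProj_cotLift (g : G) (α : CotangentBundle E Q) :
    orbitProj E Q G (cotLift g α) = orbitProj E Q G α :=
  (Quot.sound ⟨g, rfl⟩).symm

/-- The differential of an invariant map vanishes on the tangent spaces of the orbits. -/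
theorem mfderiv_eq_zero_of_mem_orbitTangent [IsManifold 𝓘(ℝ, E) ∞ Q] [TopologicalSpace G]
    {EG : Type*} [NormedAddCommGroup EG] [NormedSpace ℝ EG] [ChartedSpace EG G]
    {EN : Type*} [NormedAddCommGroup EN] [NormedSpace ℝ EN]
    {N : Type*} [TopologicalSpace N] [ChartedSpace EN N]
    {f : CotangentBundle E Q → N} {α : CotangentBundle E Q}
    (hf : MDifferentiableAt (cotModel E) 𝓘(ℝ, EN) f α) (hfG : ∀ g : G, f (cotLift g α) = f α)
    {v : TangentSpace (cotModel E) α} (hv : v ∈ orbitTangent G EG α) :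
    (show EN from mfderiv (cotModel E) 𝓘(ℝ, EN) f α v) = 0 := by
  obtain ⟨ξ, rfl⟩ := hv
  -- `orbitTangent` is the range of an `mfderiv`; where the orbit map is not differentiable this is
  -- the default value `0`, and the claim is trivial.
  by_cases hd : MDifferentiableAt 𝓘(ℝ, EG) (cotModel E) (fun g : G => cotLift g α) 1
  · have hconst : (f ∘ fun g : G => cotLift g α) = fun _ => f α := funext hfG
    have h1 := (show HasMFDerivAt (cotModel E) 𝓘(ℝ, EN) f (cotLift (1 : G) α)
      (mfderiv (cotModel E) 𝓘(ℝ, EN) f α) from by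
        rw [cotLift_one]; exact hf.hasMFDerivAt).comp (1 : G) hd.hasMFDerivAt
    rw [hconst] at h1
    exact DFunLike.congr_fun (hasMFDerivAt_unique h1 (hasMFDerivAt_const (f α) (1 : G))) ξ
  · have h0 : mfderiv 𝓘(ℝ, EG) (cotModel E) (fun g : G => cotLift g α) 1 = 0 :=
      mfderiv_zero_of_not_mdifferentiableAt hd
    rw [h0]
    exact map_zero (mfderiv (cotModel E) 𝓘(ℝ, EN) f α)

end OrbitSpace

/-! ### The constraint distribution and the Hamiltonian field -/

namespace SymmetricSystem

variable {E : Type*} [NormedAddCommGroup E] [NormedSpace ℝ E] [FiniteDimensional ℝ E]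
  {Q : Type*} [TopologicalSpace Q] [ChartedSpace E Q] [IsManifold 𝓘(ℝ, E) ∞ Q]
  {G : Type*} [Group G] [TopologicalSpace G] [MulAction G Q]
  (S : SymmetricSystem E Q G)

theorem mem_Fdist {α : CotangentBundle E Q} {w : E × (E →L[ℝ] ℝ)} :
    w ∈ S.Fdist α ↔ w.1 ∈ S.D α.proj := by
  change mfderiv (cotModel E) 𝓘(ℝ, E) (cotProj : CotangentBundle E Q → Q) α w ∈ S.D α.proj ↔ _
  exact iff_of_eq (congrArg (· ∈ S.D α.proj) (mfderiv_cotProj α w))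

/-- `ℱ` is coisotropic. -/
theorem Fperp_le_Fdist (α : CotangentBundle E Q) : S.Fperp α ≤ S.Fdist α := by
  intro z hz
  -- All vertical vectors `(0, g)` lie in `ℱ`, and `ω((0, g), z) = -g(z.1)`. So `ℱ^⊥` is vertical,
  -- hence contained in `ℱ`.
  have h1 : (show E × (E →L[ℝ] ℝ) from z).1 = 0 := by
    by_contra h
    obtain ⟨g, hg⟩ := SeparatingDual.exists_ne_zero (R := ℝ) h
    have h2 : canonicalForm α ((0, g) : E × (E →L[ℝ] ℝ)) z = 0 :=
      hz _ (S.mem_Fdist.mpr (zero_mem (S.D α.proj)))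
    have h3 := (canonicalForm_apply α ((0, g) : E × (E →L[ℝ] ℝ)) z).symm.trans h2
    apply hg
    simpa using h3
  exact S.mem_Fdist.mpr (h1 ▸ zero_mem (S.D α.proj))

/-- The Hamiltonian vector field satisfies the nonholonomic constraint along `M`. -/
theorem hamiltonianField_mem_Fdist (hH : MDifferentiable (cotModel E) 𝓘(ℝ, ℝ) S.H)
    {α : CotangentBundle E Q} (hα : α ∈ S.M) : hamiltonianField S.H α ∈ S.Fdist α := by
  obtain ⟨x, hx, rfl⟩ := hα
  obtain ⟨Φ, hΦ⟩ := S.hyperregular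
  -- At `FL(x)` the base velocity of `X_H` is `x` itself: pairing with `(0, g)` gives `g(X_H.1) =
  -- dH(0, g) = g(x.snd)`, and covectors separate points.
  have h1 : (show E × (E →L[ℝ] ℝ) from hamiltonianField S.H (legendre S.L x)).1 =
      (show E from x.snd) := by
    rw [← sub_eq_zero]
    by_contra h
    obtain ⟨g, hg⟩ := SeparatingDual.exists_ne_zero (R := ℝ) h
    apply hg
    have h2 := canonicalForm_hamiltonianField S.H (legendre S.L x) ((0, g) : E × (E →L[ℝ] ℝ))
    rw [mfderiv_hamiltonian_fibre S.smooth_L Φ hΦ hH S.hamiltonian x g] at h2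
    have h3 := (canonicalForm_apply (legendre S.L x) (hamiltonianField S.H (legendre S.L x))
      ((0, g) : E × (E →L[ℝ] ℝ))).symm.trans h2
    rw [map_sub, sub_eq_zero]
    simpa using h3
  exact S.mem_Fdist.mpr (h1 ▸ hx)

/-! ### Comparison of the reduced field with the projection of the Hamiltonian field -/

section Reduction

variable {EG : Type*} [NormedAddCommGroup EG] [NormedSpace ℝ EG] [ChartedSpace EG G]
  {EB : Type*} [NormedAddCommGroup EB] [NormedSpace ℝ EB] [ChartedSpace EB (OrbitSpace E Q G)]
  {S}

theorem IsReducible.mdifferentiable_orbitProj (hS : S.IsReducible EB) :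
    MDifferentiable (cotModel E) 𝓘(ℝ, EB) (orbitProj E Q G) :=
  hS.smooth_proj.mdifferentiable (by simp)

theorem ReducedSystem.mdifferentiable_h (R : S.ReducedSystem EG EB) :
    MDifferentiable 𝓘(ℝ, EB) 𝓘(ℝ, ℝ) R.h :=
  R.smooth_h.mdifferentiable (by simp)

theorem ReducedSystem.h_comp (R : S.ReducedSystem EG EB) : R.h ∘ orbitProj E Q G = S.H :=
  funext R.h_proj

/-- The regularity of `H` is inherited from the smooth reduced Hamiltonian through `H = h ∘ π_{/G}`.
-/
theorem ReducedSystem.mdifferentiable_H (R : S.ReducedSystem EG EB) (hS : S.IsReducible EB) :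
    MDifferentiable (cotModel E) 𝓘(ℝ, ℝ) S.H :=
  R.h_comp ▸ R.mdifferentiable_h.comp hS.mdifferentiable_orbitProj

theorem ReducedSystem.mfderiv_h (R : S.ReducedSystem EG EB) (hS : S.IsReducible EB)
    (α : CotangentBundle E Q) (v : TangentSpace (cotModel E) α) :
    (show ℝ from mfderiv 𝓘(ℝ, EB) 𝓘(ℝ, ℝ) R.h (orbitProj E Q G α) (tangentOrbitProj G EB α v)) =
      mfderiv (cotModel E) 𝓘(ℝ, ℝ) S.H α v := by
  have h := (R.mdifferentiable_h _).hasMFDerivAt.comp α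
    (hS.mdifferentiable_orbitProj α).hasMFDerivAt
  rw [R.h_comp] at h
  exact (DFunLike.congr_fun h.mfderiv v).symm

theorem IsReducible.TM_sup_Fperp (hS : S.IsReducible EB) {α : CotangentBundle E Q}
    (hα : α ∈ S.M) : S.TM α ⊔ S.Fperp α = ⊤ :=
  sup_orthogonal_eq_top_of_finrank_eq (canonicalForm_nondegenerate α) (hS.admissible α hα)
    (hS.compatible α hα)

/-- `ω_𝒦` is nondegenerate. -/
theorem IsReducible.eq_zero_of_mem_K (hS : S.IsReducible EB) {α : CotangentBundle E Q}
    (hα : α ∈ S.M) {d : TangentSpace (cotModel E) α} (hd : d ∈ S.K α)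
    (hz : ∀ v ∈ S.K α, canonicalForm α d v = 0) : d = 0 :=
  eq_zero_of_mem_inf_of_forall (canonicalForm_isRefl α) (S.Fperp_le_Fdist α)
    (hS.compatible α hα) (hS.TM_sup_Fperp hα) hd hz

/-- Along `M`, the `TM`-component of `X_H` in `TM ⊕ ℱ^⊥` lies in `𝒦`. -/
theorem IsReducible.exists_mem_K_sub_mem_Fperp (hS : S.IsReducible EB)
    (hH : MDifferentiable (cotModel E) 𝓘(ℝ, ℝ) S.H) {α : CotangentBundle E Q} (hα : α ∈ S.M) :
    ∃ Y ∈ S.K α, hamiltonianField S.H α - Y ∈ S.Fperp α := by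
  obtain ⟨Y, hY, Z, hZ, hYZ⟩ := Submodule.mem_sup.mp
    (hS.TM_sup_Fperp hα ▸ Submodule.mem_top : hamiltonianField S.H α ∈ _)
  have h1 : hamiltonianField S.H α - Y = Z := by rw [← hYZ]; abel
  have h2 : Y = hamiltonianField S.H α - Z := by rw [← hYZ]; abel
  refine ⟨Y, ⟨?_, hY⟩, h1 ▸ hZ⟩
  rw [h2]
  exact (S.Fdist α).sub_mem (S.hamiltonianField_mem_Fdist hH hα) (S.Fperp_le_Fdist α hZ)

variable {α : CotangentBundle E Q} {Y : TangentSpace (cotModel E) α}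

/-- Since `𝒦 ⊆ ℱ`, vectors of `𝒦` do not see the `ℱ^⊥`-part of `X_H`. -/
theorem canonicalForm_eq_of_sub_mem_Fperp (hY : hamiltonianField S.H α - Y ∈ S.Fperp α)
    {v : TangentSpace (cotModel E) α} (hv : v ∈ S.K α) :
    canonicalForm α Y v = mfderiv (cotModel E) 𝓘(ℝ, ℝ) S.H α v := by
  have h1 : canonicalForm α (hamiltonianField S.H α - Y) v = 0 :=
    canonicalForm_isRefl α _ _ (hY v hv.1)
  rw [map_sub, LinearMap.sub_apply, sub_eq_zero] at h1
  rw [← h1, canonicalForm_hamiltonianField]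

/-- On `𝒱 ∩ 𝒦` the form `ω(Y, ·)` equals `dH`, which vanishes along orbits because `H` is invariant.
-/
theorem mem_U_of_sub_mem_Fperp (hH : MDifferentiable (cotModel E) 𝓘(ℝ, ℝ) S.H)
    (hYK : Y ∈ S.K α) (hY : hamiltonianField S.H α - Y ∈ S.Fperp α) : Y ∈ S.U EG α := by
  refine ⟨hYK, fun v hv => canonicalForm_isRefl α _ _ ?_⟩
  rw [canonicalForm_eq_of_sub_mem_Fperp hY hv.2]
  exact mfderiv_eq_zero_of_mem_orbitTangent (hH α) (fun g => S.H_invariant g α) hv.1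

/-- `X_𝒦̄` is the projection of the `𝒦`-component of `X_H`. -/
theorem ReducedSystem.X_eq_tangentOrbitProj (R : S.ReducedSystem EG EB) (hS : S.IsReducible EB)
    (hα : α ∈ S.M) (hYK : Y ∈ S.K α) (hY : hamiltonianField S.H α - Y ∈ S.Fperp α) :
    R.X (orbitProj E Q G α) = tangentOrbitProj G EB α Y := by
  have hYU : Y ∈ S.U EG α := mem_U_of_sub_mem_Fperp (R.mdifferentiable_H hS) hYK hY
  obtain ⟨x, hx, hxX⟩ := R.X_mem α hα
  -- The lift `x` is determined only up to the kernel of `Tπ_{/G}`, so `x = Y` is not to be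
  -- expected. For `w ∈ 𝒰` both `ω(x, w)` and `ω(Y, w)` equal `dH(w)`, which forces the difference
  -- into `𝒱`.
  have hxY : x - Y ∈ orbitTangent G EG α := by
    refine mem_of_forall_inf_orthogonal (canonicalForm_nondegenerate α) (canonicalForm_isRefl α)
      (fun d hd hz => hS.eq_zero_of_mem_K hα hd hz) ((S.K α).sub_mem hx.1 hYK) fun w hw => ?_
    rw [map_sub, LinearMap.sub_apply, sub_eq_zero, canonicalForm_eq_of_sub_mem_Fperp hY hw.1,
      ← R.form_proj α hα x hx w hw, hxX, R.X_eq α hα _ ⟨w, hw, rfl⟩]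
    exact R.mfderiv_h hS α w
  have h0 : tangentOrbitProj G EB α (x - Y) = 0 :=
    mfderiv_eq_zero_of_mem_orbitTangent (hS.mdifferentiable_orbitProj α)
      (fun g => orbitProj_cotLift g α) hxY
  rw [← hxX, ← sub_eq_zero, ← map_sub, h0]

/-- `τ_𝒦̄ · Tπ_{/G} · X_H = X_𝒦̄ · π_{/G}` along `M`. -/
theorem ReducedSystem.tauKbar_hamiltonianField (R : S.ReducedSystem EG EB)
    (hS : S.IsReducible EB) (hα : α ∈ S.M) :
    S.tauKbar EG EB α (tangentOrbitProj G EB α (hamiltonianField S.H α)) =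
      R.X (orbitProj E Q G α) := by
  have hH := R.mdifferentiable_H hS
  obtain ⟨Y, hYK, hY⟩ := hS.exists_mem_K_sub_mem_Fperp hH hα
  rw [R.X_eq_tangentOrbitProj hS hα hYK hY]
  refine projAlong_eq ?_ ⟨Y, mem_U_of_sub_mem_Fperp hH hYK hY, rfl⟩
    ⟨_, hY, map_sub (tangentOrbitProj G EB α) _ _⟩
  -- `𝒰 ⊆ 𝒦 ⊆ TM` gives `𝒦̄ ⊆ TM̄`, so `𝒦̄` also meets `ℱ̄^⊥` trivially and the projection is
  -- unambiguous.
  exact (hS.compatible_bar α hα).mono_left (Submodule.map_mono fun v hv => hv.1.2)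

end Reduction

end SymmetricSystem

end NonholonomicRCH

/-! ### The Type II Hamilton-Jacobi theorem -/

open NonholonomicRCH in
theorem theorem4p3
    {E : Type*} [NormedAddCommGroup E] [NormedSpace ℝ E] [FiniteDimensional ℝ E]
    {Q : Type*} [TopologicalSpace Q] [T2Space Q] [SecondCountableTopology Q]
    [ChartedSpace E Q] [IsManifold 𝓘(ℝ, E) ∞ Q]
    {EG : Type*} [NormedAddCommGroup EG] [NormedSpace ℝ EG] [FiniteDimensional ℝ EG]
    {G : Type*} [Group G] [TopologicalSpace G] [T2Space G] [SecondCountableTopology G]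
    [ChartedSpace EG G] [LieGroup 𝓘(ℝ, EG) ∞ G]
    [MulAction G Q] [ContMDiffSMul 𝓘(ℝ, EG) 𝓘(ℝ, E) ∞ G Q]
    {EB : Type*} [NormedAddCommGroup EB] [NormedSpace ℝ EB] [FiniteDimensional ℝ EB]
    [ChartedSpace EB (OrbitSpace E Q G)] [IsManifold 𝓘(ℝ, EB) ∞ (OrbitSpace E Q G)]
    (S : SymmetricSystem E Q G) (hS : S.IsReducible EB)
    (XK : ∀ α : CotangentBundle E Q, TangentSpace (cotModel E) α)
    (hXK : S.IsNonholonomicField XK)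
    (R : S.ReducedSystem EG EB)
    (γ : ∀ q : Q, TangentSpace 𝓘(ℝ, E) q →L[ℝ] Trivial Q ℝ q)
    (hγ : ContMDiff 𝓘(ℝ, E) (cotModel E) ∞ (sectionMap γ))
    (hγM : ∀ q, sectionMap γ q ∈ S.M)
    (hγG : ∀ (g : G) (q : Q), sectionMap γ (g • q) = cotLift g (sectionMap γ q))
    (ε : CotangentBundle E Q → CotangentBundle E Q)
    (hε : IsSymplecticMap ε)
    (hεG : ∀ (g : G) (α : CotangentBundle E Q), ε (cotLift g α) = cotLift g (ε α))
    (hεM : ∀ α ∈ S.M, ε α ∈ S.M)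
    (A : Set (CotangentBundle E Q)) (hA : A ⊆ S.M) :
    (∀ α ∈ A,
      (⟨orbitProj E Q G (ε α), S.tauKbar EG EB (ε α)
          (mfderiv (cotModel E) 𝓘(ℝ, EB) (fun β => orbitProj E Q G (ε β)) α
            (hamiltonianField (fun β => R.h (orbitProj E Q G (ε β))) α))⟩ :
        TangentBundle 𝓘(ℝ, EB) (OrbitSpace E Q G)) =
      tangentMap (cotModel E) 𝓘(ℝ, EB)
        (fun β => orbitProj E Q G (sectionMap γ (cotProj β)))
        ⟨ε α, S.dynamicalField XK (ε α)⟩) ↔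
    (∀ α ∈ A,
      tangentMap 𝓘(ℝ, E) 𝓘(ℝ, EB) (fun q => orbitProj E Q G (sectionMap γ q))
        (tangentMap (cotModel E) 𝓘(ℝ, E) cotProj ⟨ε α, S.dynamicalField XK (ε α)⟩) =
      ⟨orbitProj E Q G (ε α), R.X (orbitProj E Q G (ε α))⟩) := by
  have hH := R.mdifferentiable_H hS
  have hπ := hS.mdifferentiable_orbitProj
  refine forall₂_congr fun α hα => ?_
  have hεα : ε α ∈ S.M := hεM α (hA hα)
  -- An identity at every point of `M`, independent of either equation: `ε(α) ∈ M`, so the projected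
  -- `X_H` can be evaluated there.
  have hleft : S.tauKbar EG EB (ε α)
      (mfderiv (cotModel E) 𝓘(ℝ, EB) (fun β => orbitProj E Q G (ε β)) α
        (hamiltonianField (fun β => R.h (orbitProj E Q G (ε β))) α)) =
      R.X (orbitProj E Q G (ε α)) := by
    have h1 : (fun β => R.h (orbitProj E Q G (ε β))) = fun β => S.H (ε β) :=
      funext fun β => R.h_proj (ε β)
    have h2 : mfderiv (cotModel E) 𝓘(ℝ, EB) (fun β => orbitProj E Q G (ε β)) α = _ :=
      mfderiv_comp α (hπ (ε α)) (hε.1.mdifferentiable (by simp) α)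
    rw [h1, h2, ← R.tauKbar_hamiltonianField hS hεα, ← hε.mfderiv_hamiltonianField hH α]
    rfl
  have hγd : MDifferentiable 𝓘(ℝ, E) 𝓘(ℝ, EB) (fun q => orbitProj E Q G (sectionMap γ q)) :=
    hπ.comp (hγ.mdifferentiable (by simp))
  have hproj : MDifferentiable (cotModel E) 𝓘(ℝ, E) (cotProj : CotangentBundle E Q → Q) :=
    (contMDiff_proj (n := 1) _).mdifferentiable one_ne_zero
  -- Chain rule for `λ̄ = γ̄ ∘ π_Q`; after rewriting, the two equations differ only by symmetry of
  -- equality.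
  have hright := tangentMap_comp_at (⟨ε α, S.dynamicalField XK (ε α)⟩ :
    TangentBundle (cotModel E) (CotangentBundle E Q)) (hγd _) (hproj _)
  rw [hleft, ← hright]
  exact eq_comm
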